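/- Let $\mathcal X\subseteq\mathbb R^n$, $\mathcal U\subseteq\mathbb R^m$, and consider the system $x(t+1)=g(x(t),u(t))$ with states constrained to $\mathcal X$ and inputs constrained to $\mathcal U$; $x(\cdot,\xi,\mathbf u)$ denotes the solution with $x(0)=\xi$ and control sequence $\mathbf u$. (Continuity of $g$ and boundedness of $g$ by class-$\mathcal K$ functions may be assumed but are not needed.) The classes $\mathcal K$, $\mathcal K_\infty$, $\mathcal{KL}$ of comparison functions are the usual ones. Let $\omega:\mathbb R^n\to\mathbb R_{\ge0}$ be continuous with $\mathcal A:=\omega^{-1}(0)\ne\emptyset$, and let $M\ge1$ be an integer. *Admissible feedback.* A map $q:\mathcal X\to\mathcal U^M$ is admissible if for $j=1,\dots,M$ we have $x(j,\xi,q(\xi))\in\mathcal X$ for all $\xi\in\mathcal X$, and there is $\kappa_j\in\mathcal K$ with $\omega(x(j,\xi,q(\xi)))\le\kappa_j(\omega(\xi))$ for all $\xi\in\mathcal X$. *Finite-step control Lyapunov function.* Let $V:\mathbb R^n\to\mathbb R_{\ge0}$ be a finite-step control Lyapunov function for the step $M$: $V$ is continuous, $\underline\alpha(\omega(\xi))\le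 V(\xi)\le\overline\alpha(\omega(\xi))$ for all $\xi\in\mathbb R^n$ with some $\underline\alpha,\overline\alpha\in\mathcal K_\infty$, and there are an admissible $q$ and $\alpha\in\mathcal K_\infty$ with $\alpha(s)<s$ for all $s>0$ such that $$V(x(M,\xi,q(\xi)))\le\alpha(V(\xi))\quad\text{for all }\xi\in\mathcal X.\tag{1}$$ For a function $\hat\kappa:\mathbb R_{\ge0}\to\mathbb R_{\ge0}$ consider also the transient bound $$V(x(i,\xi,q(\xi)))\le\hat\kappa(V(\xi))\quad\text{for all }\xi\in\mathcal X,\ i=1,\dots,M-1.\tag{2}$$ *MPC.* For a running cost $\ell:\mathbb R^n\to\mathbb R_{\ge0}$ and a horizon $N\ge1$, the optimal control problem at $\xi\in\mathcal X$ is to minimize $\sum_{i=0}^{N-1}\ell(x(i,\xi,\mathbf u))$ over all $\mathbf u=(u_0,\dots,u_{N-1})\in\mathcal U^N$ with $x(j,\xi,\mathbf u)\in\mathcal X$ for $j=1,\dots,N$. An MPC closed-loop solution is a sequence $x(0),x(1),\dots$ with $x(0)\in\mathcal X$ and $x(t+1)=g(x(t),u_0^*)$ for every $t$, where $u_0^*$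 is the first element of an optimal control sequence at $\xi=x(t)$ (minimizers are assumed to exist along the solutions considered). The closed loop with horizon $N$ is *asymptotically $\omega$-stable in $\mathcal A$* if there is $\beta\in\mathcal{KL}$ with $\omega(x(t))\le\beta(\omega(x(0)),t)$ for all $t\in\mathbb N$ and all closed-loop solutions. The scheme is *semiglobally practically asymptotically $\omega$-stabilizing in $\mathcal A$* if there is $\beta\in\mathcal{KL}$ such that for all $0<\delta<\Delta$ there is $N_{\delta,\Delta}\ge1$ such that for all $N\ge N_{\delta,\Delta}$, all closed-loop solutions with horizon $N$ and $\omega(x(0))<\Delta$ satisfy $\omega(x(t))\le\max\{\beta(\omega(x(0)),t),\delta\}$ for all $t\in\mathbb N$. Then the following hold. (i) If some admissible $q$ satisfies (1) with $\alpha(s)=cs$, $c\in[0,1)$, and (2) with $\hat\kappa(r)=dr$, $d>0$, then, with $\gamma=Md/(1-c)$, the MPC closed loop with running cost $\ell=V$ is asymptotically $\omega$-stable in $\mathcal A$ for all integers $N>2+\frac{\ln(\gamma-1)}{\ln\gamma-\ln(\gamma-1)}$ if $\gamma>1$, and for all integers $N\ge2$ if $\gamma\le1$. (ii) If some admissible $q$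 satisfies (1) with $\alpha(s)=cs$, $c\in[0,1)$, and (2) with some $\hat\kappa\in\mathcal K_\infty$ such that $\hat\kappa(r)\le p\max\{r^a,r^b\}$ for all $r\ge0$, with constants $a,b,p>0$, then the MPC scheme with running cost $\ell=V$ is semiglobally practically asymptotically $\omega$-stabilizing in $\mathcal A$. (iii) In general there is $\rho\in\mathcal K_\infty$ such that the MPC scheme with running cost $\ell=\rho(V)$ is semiglobally practically asymptotically $\omega$-stabilizing in $\mathcal A$. -/

import Mathlib

open scoped NNReal

namespace FiniteStepMPC

/-- Class `𝒦`: continuous, strictly increasing functions on `[0,∞)` that vanish at zero. -/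
def IsClassK (f : ℝ≥0 → ℝ≥0) : Prop :=
  Continuous f ∧ StrictMono f ∧ f 0 = 0

/-- Class `𝒦_∞`: unbounded class `𝒦` functions. -/
def IsClassKInf (f : ℝ≥0 → ℝ≥0) : Prop :=
  IsClassK f ∧ Filter.Tendsto f Filter.atTop Filter.atTop

/-- Class `𝒦ℒ`: jointly continuous, of class `𝒦` in the first argument, and decreasing to zero in
the second one. -/
def IsClassKL (β : ℝ≥0 → ℝ≥0 → ℝ≥0) : Prop :=
  Continuous (Function.uncurry β) ∧
  (∀ s, IsClassK fun r => β r s) ∧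
  ∀ r, Antitone (β r) ∧ Filter.Tendsto (β r) Filter.atTop (nhds 0)

/-- A measurement function: continuous, nonnegative, with nonempty zero set. -/
def IsMeasurementFunction {E : Type*} [TopologicalSpace E] (ω : E → ℝ≥0) : Prop :=
  Continuous ω ∧ (ω ⁻¹' {0}).Nonempty

/-- The solution `x(j, ξ, u)` of `x(t+1) = g (x t) (u t)`, `x 0 = ξ`. The value at time `j` depends
only on `u 0, …, u (j-1)`, so a control sequence of length `N` is represented by a sequence of which
only the first `N` entries matter. -/
def solution {E F : Type*} (g : E → F → E) (ξ : E) (u : ℕ → F) : ℕ → E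
  | 0 => ξ
  | j + 1 => g (solution g ξ u j) (u j)

/-- Admissible finite-step feedback control law of length `M` for the system `g` with state
constraint set `X` and input constraint set `U` (only the first `M` entries of `q ξ`, for `ξ ∈ X`,
matter). -/
def IsAdmissibleFeedback {E F : Type*} (g : E → F → E) (X : Set E) (U : Set F) (ω : E → ℝ≥0)
    (M : ℕ) (q : E → ℕ → F) : Prop :=
  (∀ ξ ∈ X, ∀ j < M, q ξ j ∈ U) ∧
  (∀ ξ ∈ X, ∀ j, 1 ≤ j → j ≤ M → solution g ξ (q ξ) j ∈ X) ∧
  ∀ j, 1 ≤ j → j ≤ M → ∃ κ, IsClassK κ ∧ ∀ ξ ∈ X, ω (solution g ξ (q ξ) j) ≤ κ (ω ξ)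

/-- The decay estimate `V (x(M, ξ, u_q)) ≤ α (V ξ)` on `X`. -/
def HasDecay {E F : Type*} (g : E → F → E) (X : Set E) (V : E → ℝ≥0) (M : ℕ)
    (q : E → ℕ → F) (α : ℝ≥0 → ℝ≥0) : Prop :=
  ∀ ξ ∈ X, V (solution g ξ (q ξ) M) ≤ α (V ξ)

/-- The transient bound `V (x(i, ξ, u_q)) ≤ κ (V ξ)` on `X`, for `i = 1, …, M - 1`. -/
def HasTransientBound {E F : Type*} (g : E → F → E) (X : Set E) (V : E → ℝ≥0) (M : ℕ)
    (q : E → ℕ → F) (κ : ℝ≥0 → ℝ≥0) : Prop :=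
  ∀ ξ ∈ X, ∀ i, 1 ≤ i → i < M → V (solution g ξ (q ξ) i) ≤ κ (V ξ)

/-- `V` is a finite-step control Lyapunov function for the time step `M`. -/
def IsFiniteStepCLF {E F : Type*} [TopologicalSpace E] (g : E → F → E) (X : Set E) (U : Set F)
    (ω : E → ℝ≥0) (M : ℕ) (V : E → ℝ≥0) : Prop :=
  Continuous V ∧
  (∃ αl αu, IsClassKInf αl ∧ IsClassKInf αu ∧ ∀ ξ, αl (ω ξ) ≤ V ξ ∧ V ξ ≤ αu (ω ξ)) ∧
  ∃ q α, IsAdmissibleFeedback g X U ω M q ∧ IsClassKInf α ∧ (∀ s, 0 < s → α s < s) ∧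
    HasDecay g X V M q α

/-- Feasibility of a control sequence of length `N` at the initial value `ξ`. -/
def IsFeasible {E F : Type*} (g : E → F → E) (X : Set E) (U : Set F) (N : ℕ) (ξ : E)
    (u : ℕ → F) : Prop :=
  ∀ j < N, u j ∈ U ∧ solution g ξ u (j + 1) ∈ X

/-- The cost over the horizon `N` with running cost `ℓ`. -/
def cost {E F : Type*} (g : E → F → E) (ℓ : E → ℝ≥0) (N : ℕ) (ξ : E) (u : ℕ → F) : ℝ≥0 :=
  ∑ i ∈ Finset.range N, ℓ (solution g ξ u i)

/-- `u` solves the optimal control problem with running cost `ℓ`, horizon `N`, initial value `ξ`,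
without terminal cost or terminal constraints. -/
def IsOptimal {E F : Type*} (g : E → F → E) (X : Set E) (U : Set F) (ℓ : E → ℝ≥0) (N : ℕ)
    (ξ : E) (u : ℕ → F) : Prop :=
  IsFeasible g X U N ξ u ∧ ∀ v, IsFeasible g X U N ξ v → cost g ℓ N ξ u ≤ cost g ℓ N ξ v

/-- `x` is a closed-loop solution of classic MPC with running cost `ℓ` and horizon `N`: it starts in
`X`, and at each time `t` the first element of some optimal control sequence for the initial value
`x t` is applied. In particular this holds for every solution of `x (t+1) = g (x t) (μ (x t))` when
the feedback `μ` assigns to each point of `X` the first element of an optimal control sequence. -/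
def IsMPCSolution {E F : Type*} (g : E → F → E) (X : Set E) (U : Set F) (ℓ : E → ℝ≥0) (N : ℕ)
    (x : ℕ → E) : Prop :=
  x 0 ∈ X ∧ ∀ t, ∃ u, IsOptimal g X U ℓ N (x t) u ∧ x (t + 1) = g (x t) (u 0)

/-- The MPC closed loop with running cost `ℓ` and horizon `N` is asymptotically `ω`-stable in
`ω ⁻¹' {0}`. -/
def MPCAsymptoticallyStable {E F : Type*} (g : E → F → E) (X : Set E) (U : Set F) (ω : E → ℝ≥0)
    (ℓ : E → ℝ≥0) (N : ℕ) : Prop :=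
  ∃ β, IsClassKL β ∧ ∀ x, IsMPCSolution g X U ℓ N x → ∀ t : ℕ, ω (x t) ≤ β (ω (x 0)) t

/-- The MPC scheme with running cost `ℓ` is semiglobally practically asymptotically `ω`-stabilizing
in `ω ⁻¹' {0}` with respect to the optimization horizon. -/
def MPCSemigloballyPracticallyStabilizing {E F : Type*} (g : E → F → E) (X : Set E) (U : Set F)
    (ω : E → ℝ≥0) (ℓ : E → ℝ≥0) : Prop :=
  ∃ β, IsClassKL β ∧ ∀ δ Δ : ℝ≥0, 0 < δ → δ < Δ → ∃ N₀ : ℕ, 1 ≤ N₀ ∧ ∀ N ≥ N₀,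
    ∀ x, IsMPCSolution g X U ℓ N x → ω (x 0) < Δ →
      ∀ t : ℕ, ω (x t) ≤ max (β (ω (x 0)) t) δ

end FiniteStepMPC

open FiniteStepMPC

/-! Everything rests on a bound `V_N(ξ) ≤ B(ℓ ξ)` for the optimal value `V_N`. Applying `q`
repeatedly in blocks of `M` steps supplies one, uniform in `N`, once a potential `D` pays for the
cost of each block by its decrease (`exists_feasible_cost_le_of_potential`): `D` is linear in (i)
for `M ≥ 2`, `d ≥ 1`, a sum of powers in (ii). In (iii), `exists_rescaling` first makes the decay
linear, and `ρ` also undoes the transient growth. To bound `V_N` at the successor state, follow the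
old prediction up to some time and switch there to a cheap control. For linear `B`, comparing all
switching times gives a contraction of `V_N` under the stated horizon condition. For general `B`, a
long prediction must visit a state of small running cost; switching there gives decrease up to an
error that vanishes as `N → ∞`, hence practical stability. If one step already decreases `V` by a
factor, geometric sums depending on the horizon are sharp enough for every `N ≥ 2`. -/

namespace FiniteStepMPC

/-! ### Concatenation of controls and dynamic programming inequalities -/

section ControlSequences

variable {E F : Type*} {g : E → F → E} {X : Set E} {U : Set F} {ℓ : E → ℝ≥0}

/-- The control sequence that follows `u` for `k` steps and then `v`. -/
def splice (k : ℕ) (u v : ℕ → F) : ℕ → F := fun i => if i < k then u i else v (i - k)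

lemma solution_congr (ξ : E) {u v : ℕ → F} {j : ℕ} (h : ∀ i < j, u i = v i) :
    solution g ξ u j = solution g ξ v j := by
  induction j with
  | zero => rfl
  | succ j ih =>
    simp only [solution]
    rw [ih fun i hi => h i (by omega), h j (by omega)]

lemma solution_add (ξ : E) (u : ℕ → F) (k j : ℕ) :
    solution g ξ u (k + j) = solution g (solution g ξ u k) (fun i => u (k + i)) j := by
  induction j with
  | zero => rfl
  | succ j ih => rw [← add_assoc]; simp only [solution]; rw [ih]

lemma cost_congr (ξ : E) {u v : ℕ → F} {k : ℕ} (h : ∀ i < k, u i = v i) :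
    cost g ℓ k ξ u = cost g ℓ k ξ v := by
  refine Finset.sum_congr rfl fun i hi => ?_
  rw [solution_congr ξ fun j hj => h j (hj.trans (Finset.mem_range.1 hi))]

lemma cost_succ (ξ : E) (u : ℕ → F) (k : ℕ) :
    cost g ℓ (k + 1) ξ u = cost g ℓ k ξ u + ℓ (solution g ξ u k) :=
  Finset.sum_range_succ _ _

lemma cost_add (ξ : E) (u : ℕ → F) (k j : ℕ) :
    cost g ℓ (k + j) ξ u =
      cost g ℓ k ξ u + cost g ℓ j (solution g ξ u k) (fun i => u (k + i)) := by
  simp only [cost, Finset.sum_range_add, solution_add]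

lemma cost_one (ξ : E) (u : ℕ → F) : cost g ℓ 1 ξ u = ℓ ξ := by
  simp [cost, solution]

lemma cost_mono (ξ : E) (u : ℕ → F) {k j : ℕ} (h : k ≤ j) :
    cost g ℓ k ξ u ≤ cost g ℓ j ξ u := by
  obtain ⟨i, rfl⟩ := Nat.exists_eq_add_of_le h
  rw [cost_add]
  exact le_self_add

lemma le_cost (ξ : E) (u : ℕ → F) {N : ℕ} (h : 1 ≤ N) : ℓ ξ ≤ cost g ℓ N ξ u := by
  simpa only [cost_one] using cost_mono (g := g) (ℓ := ℓ) ξ u h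

lemma splice_of_lt (u v : ℕ → F) {k i : ℕ} (h : i < k) : splice k u v i = u i := by
  simp [splice, h]

lemma splice_add (u v : ℕ → F) (k : ℕ) : (fun i => splice k u v (k + i)) = v := by
  funext i
  simp [splice]

lemma solution_splice_of_le (ξ : E) (u v : ℕ → F) {k j : ℕ} (h : j ≤ k) :
    solution g ξ (splice k u v) j = solution g ξ u j :=
  solution_congr ξ fun _ hi => splice_of_lt u v (hi.trans_le h)

lemma solution_splice_add (ξ : E) (u v : ℕ → F) (k j : ℕ) :
    solution g ξ (splice k u v) (k + j) = solution g (solution g ξ u k) v j := by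
  rw [solution_add, splice_add, solution_splice_of_le ξ u v le_rfl]

lemma cost_splice (ξ : E) (u v : ℕ → F) (k j : ℕ) :
    cost g ℓ (k + j) ξ (splice k u v) =
      cost g ℓ k ξ u + cost g ℓ j (solution g ξ u k) v := by
  rw [cost_add, splice_add, solution_splice_of_le ξ u v le_rfl,
    cost_congr ξ fun i hi => splice_of_lt u v hi]

lemma IsFeasible.mono {ξ : E} {u : ℕ → F} {k j : ℕ} (hu : IsFeasible g X U j ξ u) (h : k ≤ j) :
    IsFeasible g X U k ξ u :=
  fun i hi => hu i (hi.trans_le h)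

lemma IsFeasible.shift {ξ : E} {u : ℕ → F} {k j : ℕ} (hu : IsFeasible g X U (k + j) ξ u) :
    IsFeasible g X U j (solution g ξ u k) (fun i => u (k + i)) := by
  intro i hi
  rw [← solution_add, ← add_assoc]
  exact hu (k + i) (by omega)

lemma IsFeasible.splice {ξ : E} {u v : ℕ → F} {k j : ℕ} (hu : IsFeasible g X U k ξ u)
    (hv : IsFeasible g X U j (solution g ξ u k) v) :
    IsFeasible g X U (k + j) ξ (splice k u v) := by
  intro i hi
  by_cases h : i < k
  · rw [splice_of_lt u v h, solution_splice_of_le ξ u v h]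
    exact hu i h
  · obtain ⟨l, rfl⟩ := Nat.exists_eq_add_of_le (not_lt.1 h)
    rw [add_assoc, solution_splice_add, congrFun (splice_add u v k) l]
    exact hv l (by omega)

lemma IsFeasible.solution_mem {ξ : E} (hξ : ξ ∈ X) {u : ℕ → F} {k : ℕ}
    (hu : IsFeasible g X U k ξ u) : solution g ξ u k ∈ X := by
  cases k with
  | zero => exact hξ
  | succ k => exact (hu k k.lt_succ_self).2

/-- The tail of an optimal trajectory is optimal. -/
lemma IsOptimal.cost_le_cost_add {ξ : E} {u v : ℕ → F} {k j : ℕ}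
    (hu : IsOptimal g X U ℓ (k + j) ξ u) (hv : IsFeasible g X U j (solution g ξ u k) v) :
    cost g ℓ (k + j) ξ u ≤ cost g ℓ k ξ u + cost g ℓ j (solution g ξ u k) v := by
  rw [← cost_splice]
  exact hu.2 _ ((hu.1.mono (Nat.le_add_right k j)).splice hv)

/-- The optimal value at the successor state is bounded by the cost of following the predicted
trajectory for some time and any feasible control sequence afterwards. -/
lemma IsOptimal.cost_succ_le {ξ : E} {u u' v : ℕ → F} {k j : ℕ}
    (hu : IsFeasible g X U (k + 1) ξ u) (hu' : IsOptimal g X U ℓ (k + j) (g ξ (u 0)) u')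
    (hv : IsFeasible g X U j (solution g ξ u (k + 1)) v) :
    cost g ℓ (k + j) (g ξ (u 0)) u' + ℓ ξ ≤
      cost g ℓ (k + 1) ξ u + cost g ℓ j (solution g ξ u (k + 1)) v := by
  have h1 : solution g ξ u 1 = g ξ (u 0) := rfl
  rw [add_comm k 1] at hu hv ⊢
  -- The competitor drops the first input of `u` and then continues with `v`. Its first `k` costs
  -- are those at times `1, …, k` of the prediction, so adding `ℓ ξ` completes the sum over `k + 1`
  -- times.
  have hs := hu.shift
  rw [h1] at hs
  rw [solution_add, h1] at hv ⊢
  have h := hu'.2 _ (hs.splice hv)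
  rw [cost_splice] at h
  rw [cost_add ξ u 1 k, cost_one, h1, add_comm _ (ℓ ξ), add_assoc]
  gcongr

/-- If every state admits a finite sequence of controls along which the potential `D` decreases by
at least the incurred cost, then `D` bounds the optimal value for every horizon. -/
lemma exists_feasible_cost_le_of_potential {M : ℕ} (hM : 1 ≤ M) (D : E → ℝ≥0)
    (h : ∀ ξ ∈ X, ∃ u, IsFeasible g X U M ξ u ∧
      cost g ℓ M ξ u + D (solution g ξ u M) ≤ D ξ) (N : ℕ) :
    ∀ ξ ∈ X, ∃ u, IsFeasible g X U N ξ u ∧ cost g ℓ N ξ u ≤ D ξ := by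
  induction N using Nat.strong_induction_on with
  | _ N ih =>
    intro ξ hξ
    obtain ⟨u, hu, hD⟩ := h ξ hξ
    -- `N` need not be a multiple of `M`: the last block is truncated, which only lowers the cost.
    rcases le_total N M with hN | hN
    · exact ⟨u, hu.mono hN, (cost_mono ξ u hN).trans (le_self_add.trans hD)⟩
    · obtain ⟨j, rfl⟩ := Nat.exists_eq_add_of_le hN
      obtain ⟨v, hv, hvD⟩ := ih j (by omega) _ (hu.solution_mem hξ)
      refine ⟨_, hu.splice hv, ?_⟩
      rw [cost_splice]
      exact (add_le_add_right hvD _).trans hD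

lemma IsAdmissibleFeedback.isFeasible {ω : E → ℝ≥0} {M : ℕ} {q : E → ℕ → F}
    (hq : IsAdmissibleFeedback g X U ω M q) {ξ : E} (hξ : ξ ∈ X) : IsFeasible g X U M ξ (q ξ) :=
  fun j hj => ⟨hq.1 ξ hξ j hj, hq.2.1 ξ hξ (j + 1) (by omega) hj⟩

lemma IsMPCSolution.mem {N : ℕ} (hN : 1 ≤ N) {x : ℕ → E} (hx : IsMPCSolution g X U ℓ N x)
    (t : ℕ) : x t ∈ X := by
  cases t with
  | zero => exact hx.1
  | succ t =>
    obtain ⟨u, hu, ht⟩ := hx.2 t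
    rw [ht]
    exact (hu.1 0 hN).2

end ControlSequences

/-! ### Comparison functions and linearization of contractions -/

section ComparisonFunctions

open Filter Topology

lemma isClassKInf_orderIso (e : ℝ≥0 ≃o ℝ≥0) : IsClassKInf e :=
  ⟨⟨e.continuous, e.strictMono, e.map_bot⟩, e.tendsto_atTop⟩

/-- Turns class `𝒦_∞` functions into automorphisms of `[0,∞)`, so that inverses and integer powers
are available and again of class `𝒦_∞`. -/
lemma IsClassKInf.exists_orderIso {f : ℝ≥0 → ℝ≥0} (hf : IsClassKInf f) :
    ∃ e : ℝ≥0 ≃o ℝ≥0, ⇑e = f := by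
  have hs : Function.Surjective f := by
    refine hf.1.1.surjective hf.2 ?_
    rw [OrderBot.atBot_eq]
    have h := tendsto_pure_pure f ⊥
    rwa [show f ⊥ = ⊥ from hf.1.2.2] at h
  exact ⟨hf.1.2.1.orderIsoOfSurjective f hs, rfl⟩

lemma IsClassKInf.comp {f h : ℝ≥0 → ℝ≥0} (hf : IsClassKInf f) (hh : IsClassKInf h) :
    IsClassKInf (f ∘ h) :=
  ⟨⟨hf.1.1.comp hh.1.1, hf.1.2.1.comp hh.1.2.1, by simp [hh.1.2.2, hf.1.2.2]⟩, hf.2.comp hh.2⟩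

/-- A function of class `𝒦` composed with one of class `𝒦`. -/
lemma IsClassK.comp {f h : ℝ≥0 → ℝ≥0} (hf : IsClassK f) (hh : IsClassK h) :
    IsClassK (f ∘ h) :=
  ⟨hf.1.comp hh.1, hf.2.1.comp hh.2.1, by simp [hh.2.2, hf.2.2]⟩

lemma isClassKInf_id : IsClassKInf fun r => r :=
  ⟨⟨continuous_id, strictMono_id, rfl⟩, tendsto_id⟩

lemma isClassKInf_id_add {f : ℝ≥0 → ℝ≥0} (hc : Continuous f) (hm : Monotone f) (h0 : f 0 = 0) :
    IsClassKInf fun r => r + f r :=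
  ⟨⟨continuous_id.add hc, strictMono_id.add_monotone hm, by simp [h0]⟩,
    tendsto_atTop_mono (fun _ => le_self_add) tendsto_id⟩

lemma IsClassKInf.const_mul {f : ℝ≥0 → ℝ≥0} (hf : IsClassKInf f) {C : ℝ≥0} (hC : 0 < C) :
    IsClassKInf fun r => C * f r :=
  ⟨⟨continuous_const.mul hf.1.1, fun _ _ h => mul_lt_mul_of_pos_left (hf.1.2.1 h) hC,
    by simp [hf.1.2.2]⟩, Tendsto.const_mul_atTop hC hf.2⟩

lemma isClassKL_of_rpow {P Q : ℝ≥0 → ℝ≥0} (hP : IsClassK P) (hQ : IsClassK Q) {θ : ℝ≥0}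
    (h0 : 0 < θ) (h1 : θ < 1) : IsClassKL fun r s => P (θ ^ (s : ℝ) * Q r) := by
  have hc : Continuous fun s : ℝ≥0 => θ ^ (s : ℝ) :=
    continuous_iff_continuousAt.2 fun s =>
      continuousAt_const.nnrpow NNReal.continuous_coe.continuousAt (Or.inl h0.ne')
  refine ⟨?_, fun s => ?_, fun r => ⟨fun s s' h => ?_, ?_⟩⟩
  · exact hP.1.comp ((hc.comp continuous_snd).mul (hQ.1.comp continuous_fst))
  · refine ⟨hP.1.comp (continuous_const.mul hQ.1), fun r r' h => hP.2.1 ?_, by simp [hQ.2.2, hP.2.2]⟩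
    exact mul_lt_mul_of_pos_left (hQ.2.1 h) (NNReal.rpow_pos h0)
  · refine hP.2.1.monotone ?_
    gcongr ?_ * _
    exact NNReal.rpow_le_rpow_of_exponent_ge h0 h1.le (by exact_mod_cast h)
  · have ht : Tendsto (fun s : ℝ≥0 => θ ^ (s : ℝ)) atTop (𝓝 0) := by
      rw [← NNReal.tendsto_coe]
      simp only [NNReal.coe_rpow, NNReal.coe_zero]
      exact (tendsto_rpow_atTop_of_base_lt_one _ (by linarith [θ.coe_nonneg])
        (by exact_mod_cast h1)).comp (NNReal.tendsto_coe_atTop.2 tendsto_id)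
    have := (hP.1.tendsto (0 * Q r)).comp (ht.mul_const (Q r))
    simpa [Function.comp_def, hP.2.2] using this

/-- The iterates of a contraction of class `𝒦_∞` converge to zero. -/
lemma tendsto_iterate_zero {f : ℝ≥0 → ℝ≥0} (hc : Continuous f) (hlt : ∀ s, 0 < s → f s < s)
    (h0 : f 0 = 0) (r : ℝ≥0) : Tendsto (fun n => f^[n] r) atTop (𝓝 0) := by
  have hle : ∀ s, f s ≤ s := fun s => by
    rcases eq_or_ne s 0 with rfl | h
    · exact h0.le
    · exact (hlt s (pos_iff_ne_zero.2 h)).le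
  have hanti : Antitone fun n => f^[n] r :=
    antitone_nat_of_succ_le fun n => by
      rw [Function.iterate_succ_apply']
      exact hle _
  have hlim := tendsto_atTop_ciInf hanti (OrderBot.bddBelow _)
  have hfix : f (⨅ n, f^[n] r) = ⨅ n, f^[n] r := by
    refine tendsto_nhds_unique ((hc.tendsto _).comp hlim) ?_
    have := (tendsto_add_atTop_iff_nat 1).2 hlim
    simpa only [Function.comp_def, Function.iterate_succ_apply'] using this
  have hz : ⨅ n, f^[n] r = 0 := by
    by_contra h
    exact (hlt _ (pos_iff_ne_zero.2 h)).ne hfix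
  rwa [hz] at hlim

/-- Uniform convergence on bounded sets suffices; the rescaling series has no global dominating
sequence at hand. -/
lemma continuous_tsum_of_locally_dominated {ι : Type*} {f : ι → ℝ≥0 → ℝ≥0}
    (hf : ∀ j, Continuous (f j))
    (h : ∀ R, ∃ u : ι → ℝ≥0, Summable u ∧ ∀ j, ∀ r ≤ R, f j r ≤ u j) :
    Continuous fun r => ∑' j, f j r := by
  rw [continuous_iff_continuousAt]
  intro r
  obtain ⟨u, hu, hfu⟩ := h (r + 1)
  have hon : ContinuousOn (fun r => ∑' j, (f j r : ℝ)) (Set.Iio (r + 1)) := by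
    refine continuousOn_tsum (u := fun j => (u j : ℝ))
      (fun j => (NNReal.continuous_coe.comp (hf j)).continuousOn)
      (NNReal.summable_coe.2 hu) fun j s hs => ?_
    rw [Real.norm_of_nonneg (NNReal.coe_nonneg _)]
    exact_mod_cast hfu j s (le_of_lt hs)
  have hat := hon.continuousAt (Iio_mem_nhds (lt_add_one r))
  simp only [← NNReal.coe_tsum] at hat
  exact NNReal.tendsto_coe.1 hat

/-- Every contraction `α` of class `𝒦_∞` becomes linear with factor at most `1 / 2` after rescaling
by a suitable function of class `𝒦_∞`. -/
lemma exists_rescaling {α : ℝ≥0 → ℝ≥0} (hα : IsClassKInf α) (hlt : ∀ s, 0 < s → α s < s) :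
    ∃ σ, IsClassKInf σ ∧ ∀ s, σ (α s) ≤ 2⁻¹ * σ s := by
  obtain ⟨e, rfl⟩ := hα.exists_orderIso
  have hle : ∀ s, e s ≤ s := fun s => by
    rcases eq_or_ne s 0 with rfl | h
    · exact e.map_bot.le
    · exact (hlt s (pos_iff_ne_zero.2 h)).le
  have hnat : ∀ (n : ℕ) r, (e ^ (n : ℤ)) r = e^[n] r := by
    intro n
    induction n with
    | zero => intro r; rfl
    | succ n ih =>
      intro r
      rw [Function.iterate_succ_apply, ← ih, Nat.cast_succ, zpow_add_one]
      rfl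
  have hanti : ∀ r, Antitone fun j : ℤ => (e ^ j) r := fun r =>
    antitone_int_of_succ_le fun j => by
      rw [add_comm, zpow_one_add]
      exact hle _
  -- The two-sided sum `S r = ∑ 2 ^ j * φ (α^j r)` satisfies `S (α r) = S r / 2` by an index shift.
  -- It converges because `φ` vanishes on `[0, α 1]`, which kills large `j`, and is bounded, so that
  -- `2 ^ j` controls negative `j`.
  let φ : ℝ≥0 → ℝ≥0 := fun s => min (s - e 1) 1
  have hφc : Continuous φ := (continuous_id.sub continuous_const).min continuous_const
  have hφm : Monotone φ := fun a b h => min_le_min_right _ (tsub_le_tsub_right h _)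
  let f : ℤ → ℝ≥0 → ℝ≥0 := fun j r => 2 ^ j * φ ((e ^ j) r)
  have hfc : ∀ j, Continuous (f j) := fun j =>
    continuous_const.mul (hφc.comp (e ^ j).continuous)
  have hfm : ∀ j, Monotone (f j) := fun j a b h => by
    have := hφm ((e ^ j).monotone h)
    exact mul_le_mul_right this _
  -- uniform domination on bounded sets
  have hdom : ∀ R, ∃ C : ℝ≥0, ∀ j, ∀ r ≤ R, f j r ≤ C * 2⁻¹ ^ j.natAbs := by
    intro R
    have hpos : 0 < e 1 := by
      have := e.strictMono (zero_lt_one (α := ℝ≥0))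
      exact (zero_le).trans_lt this
    obtain ⟨J, hJ⟩ := ((tendsto_iterate_zero e.continuous hlt e.map_bot R).eventually
      (gt_mem_nhds hpos)).exists
    -- Terms with `j ≥ J` vanish; for `0 ≤ j ≤ J` the factor `4 ^ J` turns `2 ^ j` into `2⁻¹ ^ j`.
    refine ⟨4 ^ J, fun j r hr => ?_⟩
    have hφ1 : φ ((e ^ j) r) ≤ 1 := min_le_right _ _
    rcases le_total (J : ℤ) j with hj | hj
    · have h1 : (e ^ j) r ≤ e 1 :=
        ((e ^ j).monotone hr).trans ((hanti R hj).trans (by simpa only [hnat] using hJ.le))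
      have : φ ((e ^ j) r) = 0 := by
        simp only [φ, tsub_eq_zero_of_le h1]
        simp
      simp [f, this]
    · refine (mul_le_of_le_one_right zero_le hφ1).trans ?_
      rcases le_total 0 j with h0 | h0
      · lift j to ℕ using h0
        have hjJ : j ≤ J := by exact_mod_cast hj
        simp only [zpow_natCast, Int.natAbs_natCast]
        calc (2 : ℝ≥0) ^ j = 4 ^ j * 2⁻¹ ^ j := by rw [← mul_pow]; norm_num
          _ ≤ 4 ^ J * 2⁻¹ ^ j := by gcongr; norm_num
      · obtain ⟨n, rfl⟩ := Int.exists_eq_neg_ofNat h0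
        simp only [zpow_neg, zpow_natCast, Int.natAbs_neg, Int.natAbs_natCast, inv_pow]
        exact le_mul_of_one_le_left zero_le (one_le_pow₀ (by norm_num))
  have hgeom : Summable fun j : ℤ => (2⁻¹ : ℝ≥0) ^ j.natAbs := by
    have h : Summable fun n : ℕ => (2⁻¹ : ℝ) ^ n :=
      summable_geometric_of_lt_one (by norm_num) (by norm_num)
    rw [← NNReal.summable_coe]
    simp only [NNReal.coe_pow, NNReal.coe_inv, NNReal.coe_ofNat]
    exact Summable.of_nat_of_neg (by simpa only [Int.natAbs_natCast] using h)
      (by simpa only [Int.natAbs_neg, Int.natAbs_natCast] using h)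
  have hsum : ∀ r, Summable fun j => f j r := fun r => by
    obtain ⟨C, hC⟩ := hdom r
    exact NNReal.summable_of_le (fun j => hC j r le_rfl) (hgeom.mul_left C)
  let S : ℝ≥0 → ℝ≥0 := fun r => ∑' j, f j r
  have hSm : Monotone S := fun a b h =>
    (hsum a).tsum_le_tsum (fun j => hfm j h) (hsum b)
  have hSc : Continuous S := continuous_tsum_of_locally_dominated hfc fun R => by
    obtain ⟨C, hC⟩ := hdom R
    exact ⟨_, hgeom.mul_left C, hC⟩
  have hSe : ∀ r, S (e r) = 2⁻¹ * S r := fun r => by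
    simp only [S]
    rw [← NNReal.tsum_mul_left, ← (Equiv.addRight (1 : ℤ)).tsum_eq fun j => 2⁻¹ * f j r]
    refine tsum_congr fun j => ?_
    simp only [f, Equiv.coe_addRight]
    rw [zpow_add_one₀ two_ne_zero, zpow_add_one]
    have : (e ^ j * e) r = (e ^ j) (e r) := rfl
    rw [this, ← mul_assoc, mul_comm _ (2 : ℝ≥0), inv_mul_cancel_left₀ two_ne_zero]
  have hS1 : 0 < S 1 := by
    have h1 : 0 < f 0 1 := by
      have := hlt 1 one_pos
      simp only [f, φ, zpow_zero, one_mul]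
      exact lt_min (tsub_pos_of_lt this) one_pos
    exact h1.trans_le ((hsum 1).le_tsum' 0)
  have hSpos : ∀ r, 0 < r → 0 < S r := by
    intro r hr
    obtain ⟨n, hn⟩ := ((tendsto_iterate_zero e.continuous hlt e.map_bot 1).eventually
      (gt_mem_nhds hr)).exists
    have hit : ∀ n, S (e^[n] 1) = 2⁻¹ ^ n * S 1 := by
      intro n
      induction n with
      | zero => simp
      | succ n ih => rw [Function.iterate_succ_apply', hSe, ih, pow_succ']; ring
    exact (by rw [hit]; positivity : 0 < S (e^[n] 1)).trans_le (hSm hn.le)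
  -- `S` is only shown to be monotone; the factor `r` makes it strictly increasing and unbounded,
  -- and `α r ≤ r` keeps the factor `1 / 2`.
  refine ⟨fun r => r * S r, ⟨⟨continuous_id.mul hSc, fun a b h => ?_, zero_mul _⟩, ?_⟩, fun s => ?_⟩
  · have hb := hSpos b (zero_le.trans_lt h)
    calc a * S a ≤ a * S b := by gcongr; exact hSm h.le
      _ < b * S b := mul_lt_mul_of_pos_right h hb
  · refine tendsto_atTop_mono' _ ?_ (Tendsto.atTop_mul_const hS1 tendsto_id)
    filter_upwards [eventually_ge_atTop 1] with r hr
    have := hSm hr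
    simp only [id]
    gcongr
  · simp only
    rw [hSe]
    calc e s * (2⁻¹ * S s) ≤ s * (2⁻¹ * S s) := by gcongr; exact hle s
      _ = 2⁻¹ * (s * S s) := by ring

end ComparisonFunctions

/-! ### Contraction of the optimal value under linear bounds -/

section AsymptoticStability

variable {E F : Type*} {g : E → F → E} {X : Set E} {U : Set F} {ω ℓ : E → ℝ≥0}

/-- Geometric decay of the optimal value along the closed loop implies asymptotic stability. -/
lemma mpcAsymptoticallyStable_of_value_decay {αl αu : ℝ≥0 → ℝ≥0} (hl : IsClassKInf αl)
    (hu : IsClassKInf αu) (hb : ∀ ξ, αl (ω ξ) ≤ ℓ ξ ∧ ℓ ξ ≤ αu (ω ξ)) {N : ℕ} (hN : 1 ≤ N)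
    {Γ θ : ℝ} (hθ : θ < 1)
    (hub : ∀ ξ ∈ X, ∀ u, IsOptimal g X U ℓ N ξ u → (cost g ℓ N ξ u : ℝ) ≤ Γ * ℓ ξ)
    (hdec : ∀ ξ ∈ X, ∀ u u', IsOptimal g X U ℓ N ξ u → IsOptimal g X U ℓ N (g ξ (u 0)) u' →
      (cost g ℓ N (g ξ (u 0)) u' : ℝ) ≤ θ * cost g ℓ N ξ u) :
    MPCAsymptoticallyStable g X U ω ℓ N := by
  obtain ⟨e, rfl⟩ := hl.exists_orderIso
  -- `θ` and `Γ` may be nonpositive, while a `𝒦ℒ` bound must be strictly increasing in the state: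
  -- both are enlarged to positive constants.
  set θ' : ℝ≥0 := max θ.toNNReal 2⁻¹
  have hθ0 : 0 < θ' := lt_max_of_lt_right (by norm_num)
  have hθ1 : θ' < 1 := max_lt (by simpa using hθ) (by
    rw [← NNReal.coe_lt_coe]
    norm_num)
  have hθle : θ ≤ θ' := (Real.le_coe_toNNReal θ).trans (by exact_mod_cast le_max_left _ _)
  set Γ' : ℝ≥0 := Γ.toNNReal + 1
  have hΓle : Γ ≤ Γ' := (Real.le_coe_toNNReal Γ).trans (by exact_mod_cast le_self_add)
  refine ⟨fun r s => e.symm (θ' ^ (s : ℝ) * (Γ' * αu r)),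
    isClassKL_of_rpow (isClassKInf_orderIso e.symm).1
      (hu.const_mul (C := Γ') (by positivity)).1 hθ0 hθ1, ?_⟩
  intro x hx t
  choose u hopt hnext using hx.2
  have hmem := hx.mem hN
  have hY : ∀ t, cost g ℓ N (x t) (u t) ≤ θ' ^ t * (Γ' * ℓ (x 0)) := by
    intro t
    induction t with
    | zero =>
      rw [pow_zero, one_mul, ← NNReal.coe_le_coe, NNReal.coe_mul]
      exact (hub _ (hmem 0) _ (hopt 0)).trans (by gcongr)
    | succ t ih =>
      have h1 := hopt (t + 1)
      rw [hnext t] at h1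
      have h := hdec _ (hmem t) _ _ (hopt t) h1
      rw [← hnext t] at h
      have h2 : cost g ℓ N (x (t + 1)) (u (t + 1)) ≤ θ' * cost g ℓ N (x t) (u t) := by
        rw [← NNReal.coe_le_coe, NNReal.coe_mul]
        exact h.trans (by gcongr)
      calc _ ≤ θ' * cost g ℓ N (x t) (u t) := h2
        _ ≤ θ' * (θ' ^ t * (Γ' * ℓ (x 0))) := by gcongr
        _ = _ := by ring
  rw [e.le_symm_apply]
  calc e (ω (x t)) ≤ ℓ (x t) := (hb _).1
    _ ≤ cost g ℓ N (x t) (u t) := le_cost _ _ hN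
    _ ≤ θ' ^ t * (Γ' * ℓ (x 0)) := hY t
    _ ≤ _ := by
      simp only [NNReal.coe_natCast, NNReal.rpow_natCast]
      gcongr
      exact (hb _).2

/-- A linear bound on the optimal value yields asymptotic stability for sufficiently long
horizons. -/
lemma mpcAsymptoticallyStable_of_linear_bound {αl αu : ℝ≥0 → ℝ≥0} (hl : IsClassKInf αl)
    (hu : IsClassKInf αu) (hb : ∀ ξ, αl (ω ξ) ≤ ℓ ξ ∧ ℓ ξ ≤ αu (ω ξ)) {γ : ℝ} (hγ : 1 < γ)
    (hval : ∀ N, ∀ ξ ∈ X, ∃ u, IsFeasible g X U N ξ u ∧ (cost g ℓ N ξ u : ℝ) ≤ γ * ℓ ξ)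
    {N : ℕ} (hN : 2 ≤ N)
    (hNγ : (N : ℝ) > 2 + Real.log (γ - 1) / (Real.log γ - Real.log (γ - 1))) :
    MPCAsymptoticallyStable g X U ω ℓ N := by
  obtain ⟨m, rfl⟩ := Nat.exists_eq_add_of_le' hN
  have hγ0 : 0 < γ := by linarith
  have hγ1 : 0 < γ - 1 := by linarith
  set r : ℝ := (γ - 1) / γ with hr
  have hr0 : 0 < r := div_pos hγ1 hγ0
  have hr1 : r = 1 - 1 / γ := by rw [hr]; field_simp
  -- With `N = m + 2`, this is the horizon condition after taking logarithms. As `1 - r = 1 / γ`, it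
  -- says that the factor `r / (1 - r ^ (m + 1))` is below one.
  have hpow : r ^ (m + 1) < 1 / γ := by
    have hlog : 0 < Real.log γ - Real.log (γ - 1) :=
      sub_pos.2 (Real.log_lt_log hγ1 (by linarith))
    have h1 : Real.log (γ - 1) < m * (Real.log γ - Real.log (γ - 1)) := by
      rw [← div_lt_iff₀ hlog]
      push_cast at hNγ
      linarith
    rw [← Real.log_lt_log_iff (by positivity) (by positivity), Real.log_pow, hr,
      Real.log_div hγ1.ne' hγ0.ne', one_div, Real.log_inv]
    push_cast
    nlinarith
  have hden : 0 < 1 - r ^ (m + 1) := by linarith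
  have hγinv : 0 < 1 / γ := by positivity
  have hopt : ∀ ξ ∈ X, ∀ u, IsOptimal g X U ℓ (m + 2) ξ u →
      (cost g ℓ (m + 2) ξ u : ℝ) ≤ γ * ℓ ξ := by
    intro ξ hξ u hu
    obtain ⟨v, hv, hc⟩ := hval (m + 2) ξ hξ
    exact le_trans (by exact_mod_cast hu.2 v hv) hc
  refine mpcAsymptoticallyStable_of_value_decay hl hu hb (by omega) (Γ := γ)
    (θ := r / (1 - r ^ (m + 1))) ?_ hopt ?_
  · rw [div_lt_one hden]
    linarith
  intro ξ hξ u u' huo huo'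
  rw [div_mul_eq_mul_div, le_div_iff₀ hden]
  set Y' : ℝ := ((cost g ℓ (m + 2) (g ξ (u 0)) u' : ℝ≥0) : ℝ)
  have hstep : ∀ i ≤ m, Y' + ℓ ξ ≤ cost g ℓ (i + 1) ξ u +
      γ * ((cost g ℓ (i + 2) ξ u : ℝ) - cost g ℓ (i + 1) ξ u) := by
    intro i hi
    have hf : IsFeasible g X U (i + 1) ξ u := huo.1.mono (by omega)
    obtain ⟨v, hv, hc⟩ := hval (m + 2 - i) _ (hf.solution_mem hξ)
    have hN : m + 2 = i + (m + 2 - i) := by omega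
    have h := IsOptimal.cost_succ_le hf (hN ▸ huo') hv
    rw [← hN, ← NNReal.coe_le_coe] at h
    push_cast at h
    have h3 := cost_succ (g := g) (ℓ := ℓ) ξ u (i + 1)
    rw [h3]
    push_cast
    linarith
  -- Let `a i` be the left side. Switching at time `i + 1` gives `a i ≤ γ * (a i - a (i + 1))`,
  -- hence `a (i + 1) ≤ r * a i`, and `a 0 = Y'`. At `i = m + 1` the subtracted cost is the whole
  -- optimal value.
  have ha : ∀ i ≤ m + 1, Y' + ℓ ξ - cost g ℓ (i + 1) ξ u ≤ r ^ i * Y' := by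
    intro i
    induction i with
    | zero => intro _; simp [cost_one]
    | succ i ih =>
      intro hi
      have h1 := ih (by omega)
      have h2 := hstep i (by omega)
      have h3 : Y' + ℓ ξ - cost g ℓ (i + 2) ξ u ≤ r * (Y' + ℓ ξ - cost g ℓ (i + 1) ξ u) := by
        rw [hr, div_mul_eq_mul_div, le_div_iff₀ hγ0]
        linarith
      calc _ ≤ _ := h3
        _ ≤ r * (r ^ i * Y') := by gcongr
        _ = _ := by ring
  have h1 := ha (m + 1) le_rfl
  have h2 : (1 / γ) * (cost g ℓ (m + 2) ξ u : ℝ) ≤ ℓ ξ := by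
    rw [one_div, inv_mul_le_iff₀ hγ0]
    exact hopt ξ hξ u huo
  rw [hr1] at h1 ⊢
  linarith

/-- If the running cost can be decreased by a fixed factor in one step, then the optimal value is
bounded by the corresponding geometric sum. -/
lemma exists_feasible_cost_le_geom_sum {σ : ℝ≥0}
    (h : ∀ ξ ∈ X, ∃ u, IsFeasible g X U 1 ξ u ∧ ℓ (solution g ξ u 1) ≤ σ * ℓ ξ) (N : ℕ) :
    ∀ ξ ∈ X, ∃ u, IsFeasible g X U N ξ u ∧
      cost g ℓ N ξ u ≤ (∑ i ∈ Finset.range N, σ ^ i) * ℓ ξ := by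
  induction N with
  | zero =>
    intro ξ hξ
    obtain ⟨u, -⟩ := h ξ hξ
    exact ⟨u, fun j hj => absurd hj (by omega), by simp [cost]⟩
  | succ N ih =>
    intro ξ hξ
    obtain ⟨u, hu, hd⟩ := h ξ hξ
    obtain ⟨v, hv, hc⟩ := ih _ (hu.solution_mem hξ)
    refine ⟨splice 1 u v, add_comm N 1 ▸ hu.splice hv, ?_⟩
    rw [add_comm N 1, cost_splice, cost_one, add_comm 1 N, geom_sum_succ]
    calc _ ≤ ℓ ξ + (∑ i ∈ Finset.range N, σ ^ i) * (σ * ℓ ξ) := by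
          gcongr
          exact hc.trans (by gcongr)
      _ = _ := by ring

/-- If the running cost can be decreased by a fixed factor in one step, then the closed loop is
asymptotically stable for every horizon of length at least two. -/
lemma mpcAsymptoticallyStable_of_one_step_decay {αl αu : ℝ≥0 → ℝ≥0} (hl : IsClassKInf αl)
    (hu : IsClassKInf αu) (hb : ∀ ξ, αl (ω ξ) ≤ ℓ ξ ∧ ℓ ξ ≤ αu (ω ξ)) {σ : ℝ≥0} (hσ : σ < 1)
    (h : ∀ ξ ∈ X, ∃ u, IsFeasible g X U 1 ξ u ∧ ℓ (solution g ξ u 1) ≤ σ * ℓ ξ)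
    {N : ℕ} (hN : 2 ≤ N) : MPCAsymptoticallyStable g X U ω ℓ N := by
  obtain ⟨m, rfl⟩ := Nat.exists_eq_add_of_le' hN
  set G : ℕ → ℝ := fun n => ∑ i ∈ Finset.range n, (σ : ℝ) ^ i with hG
  have hG0 : ∀ n, 0 ≤ G n := fun n => Finset.sum_nonneg fun i _ => by positivity
  have hGs : ∀ n, G (n + 1) = 1 + σ * G n := fun n => by
    simp only [hG, geom_sum_succ, add_comm]
  have hval : ∀ N, ∀ ξ ∈ X, ∃ u, IsFeasible g X U N ξ u ∧
      (cost g ℓ N ξ u : ℝ) ≤ G N * ℓ ξ := by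
    intro N ξ hξ
    obtain ⟨u, hu, hc⟩ := exists_feasible_cost_le_geom_sum h N ξ hξ
    refine ⟨u, hu, ?_⟩
    rw [← NNReal.coe_le_coe] at hc
    push_cast at hc
    exact hc
  have hopt : ∀ ξ ∈ X, ∀ u, IsOptimal g X U ℓ (m + 2) ξ u →
      (cost g ℓ (m + 2) ξ u : ℝ) ≤ G (m + 2) * ℓ ξ := by
    intro ξ hξ u hu
    obtain ⟨v, hv, hc⟩ := hval (m + 2) ξ hξ
    exact le_trans (by exact_mod_cast hu.2 v hv) hc
  have hGpos : 0 < G (m + 2) := by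
    rw [hGs]
    have := mul_nonneg σ.coe_nonneg (hG0 (m + 1))
    linarith
  have hσN : (σ : ℝ) ^ (m + 2) < 1 := pow_lt_one₀ σ.coe_nonneg (by exact_mod_cast hσ) (by omega)
  refine mpcAsymptoticallyStable_of_value_decay hl hu hb (by omega) (Γ := G (m + 2))
    (θ := 1 - (1 - (σ : ℝ) ^ (m + 2)) / G (m + 2)) ?_ hopt ?_
  · have := div_pos (sub_pos.2 hσN) hGpos
    linarith
  intro ξ hξ u u' huo huo'
  set Y : ℝ := ((cost g ℓ (m + 2) ξ u : ℝ≥0) : ℝ)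
  -- A tail `S` over `n + 1` steps is at most `G (n + 1) * l`, with `l` its first cost; removing `l`
  -- leaves at most the fraction `σ * G n / G (n + 1)` of `S`. These fractions telescope.
  have htail : ∀ k ≤ m + 1, Y - cost g ℓ k ξ u ≤ (σ : ℝ) ^ k * G (m + 2 - k) * ℓ ξ := by
    intro k
    induction k with
    | zero =>
      intro _
      have h0 : cost g ℓ 0 ξ u = 0 := rfl
      rw [h0, NNReal.coe_zero, sub_zero, pow_zero, one_mul]
      exact hopt ξ hξ u huo
    | succ k ih =>
      intro hk
      have h1 := ih (by omega)
      obtain ⟨v, hv, hc⟩ := hval (m + 2 - k) _ ((huo.1.mono (by omega)).solution_mem hξ :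
        solution g ξ u k ∈ X)
      have hN : m + 2 = k + (m + 2 - k) := by omega
      have h2 := IsOptimal.cost_le_cost_add (k := k) (j := m + 2 - k) (hN ▸ huo) hv
      rw [← hN, ← NNReal.coe_le_coe, NNReal.coe_add] at h2
      rw [cost_succ, NNReal.coe_add]
      have hk2 : m + 2 - k = m + 2 - (k + 1) + 1 := by omega
      rw [hk2, hGs] at h1 hc
      have hGn := hG0 (m + 2 - (k + 1))
      set H := G (m + 2 - (k + 1))
      set S : ℝ := Y - cost g ℓ k ξ u
      set l : ℝ := ((ℓ (solution g ξ u k) : ℝ≥0) : ℝ)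
      have hσ0 := σ.coe_nonneg
      have hpos : 0 < 1 + σ * H := by positivity
      have hS : S ≤ (1 + σ * H) * l := by
        simp only [S]
        have h2' : Y ≤ _ := h2
        rw [hk2] at h2'
        linarith
      have hfin : (1 + σ * H) * (S - l) ≤ (1 + σ * H) * ((σ : ℝ) ^ (k + 1) * H * ℓ ξ) := by
        have h3 := mul_le_mul_of_nonneg_left h1 (mul_nonneg hσ0 hGn)
        calc (1 + σ * H) * (S - l) ≤ σ * H * S := by linarith
          _ ≤ _ := h3
          _ = _ := by ring
      have := le_of_mul_le_mul_left hfin hpos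
      simp only [S] at this
      linarith
  have hlast := htail (m + 1) le_rfl
  have hf : IsFeasible g X U (m + 1) ξ u := huo.1.mono (by omega)
  -- From the last predicted state, two terms are needed: its own cost, already in `Y`, and one
  -- appended cost, at most `σ` times it.
  obtain ⟨v, hv, hc⟩ := hval 2 _ (hf.solution_mem hξ)
  have hstep := IsOptimal.cost_succ_le hf huo' hv
  rw [← NNReal.coe_le_coe] at hstep
  push_cast at hstep
  have hY : Y = cost g ℓ (m + 1) ξ u + ℓ (solution g ξ u (m + 1)) := by
    simp only [Y]
    rw [cost_succ]
    push_cast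
    rfl
  have hG1 : G 1 = 1 := by simp [hG]
  have hG2 : G 2 = 1 + σ := by rw [hGs, hG1, mul_one]
  rw [hG2] at hc
  rw [show m + 2 - (m + 1) = 1 by omega, hG1, mul_one] at hlast
  have hlam : (ℓ (solution g ξ u (m + 1)) : ℝ) ≤ (σ : ℝ) ^ (m + 1) * ℓ ξ := by linarith
  have hlam2 := mul_le_mul_of_nonneg_left hlam σ.coe_nonneg
  have hYl : Y / G (m + 2) ≤ ℓ ξ := by
    rw [div_le_iff₀ hGpos, mul_comm]
    exact hopt ξ hξ u huo
  have hfin := mul_le_mul_of_nonneg_left hYl (sub_pos.2 hσN).le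
  calc (cost g ℓ (m + 2) (g ξ (u 0)) u' : ℝ) ≤ Y - (1 - (σ : ℝ) ^ (m + 2)) * ℓ ξ := by
        rw [pow_succ' (σ : ℝ) (m + 1)]
        linarith
    _ ≤ Y - (1 - (σ : ℝ) ^ (m + 2)) * (Y / G (m + 2)) := by linarith
    _ = _ := by ring

lemma cost_le_of_transient_bound {M : ℕ} (hM : 1 ≤ M) {ξ : E} {u : ℕ → F} {b : ℝ≥0}
    (h : ∀ i, 1 ≤ i → i < M → ℓ (solution g ξ u i) ≤ b) :
    cost g ℓ M ξ u ≤ ℓ ξ + (M - 1 : ℕ) * b := by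
  obtain ⟨m, rfl⟩ := Nat.exists_eq_add_of_le' hM
  rw [cost, Finset.sum_range_succ', add_comm]
  refine add_le_add le_rfl ?_
  have := Finset.sum_le_card_nsmul (Finset.range m) (fun i => ℓ (solution g ξ u (i + 1))) b
    fun i hi => h (i + 1) (by omega) (by simpa using Finset.mem_range.1 hi)
  simpa using this

/-- If `M = 1` or `d < 1`, one step already contracts `V`. Otherwise `γ ≥ M * d ≥ 2`, so `γ ≤ 1`
falls under one-step decay. -/
theorem mpcAsymptoticallyStable_of_linear_decay {αl αu : ℝ≥0 → ℝ≥0} (hl : IsClassKInf αl)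
    (hu : IsClassKInf αu) {V : E → ℝ≥0} (hb : ∀ ξ, αl (ω ξ) ≤ V ξ ∧ V ξ ≤ αu (ω ξ)) {M : ℕ}
    (hM : 1 ≤ M) {q : E → ℕ → F} (hq : IsAdmissibleFeedback g X U ω M q) {c d : ℝ≥0}
    (hc : c < 1) (hdec : HasDecay g X V M q (fun s => c * s))
    (htr : HasTransientBound g X V M q (fun r => d * r)) {γ : ℝ}
    (hγ : γ = (M : ℝ) * (d : ℝ) / (1 - (c : ℝ))) {N : ℕ} (hN : 2 ≤ N)
    (hNγ : 1 < γ → (N : ℝ) > 2 + Real.log (γ - 1) / (Real.log γ - Real.log (γ - 1))) :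
    MPCAsymptoticallyStable g X U ω V N := by
  have hc' : 0 < 1 - (c : ℝ) := sub_pos.2 (by exact_mod_cast hc)
  rcases hM.eq_or_lt with rfl | hM2
  · exact mpcAsymptoticallyStable_of_one_step_decay hl hu hb hc
      (fun ξ hξ => ⟨q ξ, hq.isFeasible hξ, hdec ξ hξ⟩) hN
  rcases lt_or_ge d 1 with hd | hd
  · exact mpcAsymptoticallyStable_of_one_step_decay hl hu hb hd
      (fun ξ hξ => ⟨q ξ, (hq.isFeasible hξ).mono hM, htr ξ hξ 1 le_rfl hM2⟩) hN
  have hd' : (1 : ℝ) ≤ d := by exact_mod_cast hd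
  have hM' : (2 : ℝ) ≤ M := by exact_mod_cast hM2
  have hγ1 : 1 < γ := by
    rw [hγ, lt_div_iff₀ hc']
    nlinarith [c.coe_nonneg]
  refine mpcAsymptoticallyStable_of_linear_bound hl hu hb hγ1 (fun N ξ hξ => ?_) hN (hNγ hγ1)
  have hγ0 : 0 ≤ γ := by linarith
  -- The potential `γ * V` works because `γ * (1 - c) = M * d`, which covers the block cost `V + (M
  -- - 1) * d * V` as `d ≥ 1`.
  obtain ⟨v, hv, hv'⟩ := exists_feasible_cost_le_of_potential (g := g) (U := U) (ℓ := V) hM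
    (fun ξ => γ.toNNReal * V ξ) (fun ξ hξ => by
      refine ⟨q ξ, hq.isFeasible hξ, ?_⟩
      have h1 := cost_le_of_transient_bound hM (htr ξ hξ)
      have h2 := hdec ξ hξ
      rw [← NNReal.coe_le_coe] at h1 h2 ⊢
      simp only [NNReal.coe_add, NNReal.coe_mul, NNReal.coe_natCast, Nat.cast_sub hM,
        Nat.cast_one, Real.coe_toNNReal _ hγ0] at h1 h2 ⊢
      have h3 := mul_le_mul_of_nonneg_left h2 hγ0
      have h4 : γ * (1 - c) = M * d := by rw [hγ]; field_simp
      have h5 : γ * V ξ - γ * (c * V ξ) = M * d * V ξ := by rw [← h4]; ring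
      have h6 := mul_le_mul_of_nonneg_right hd' (V ξ).coe_nonneg
      linarith) N ξ hξ
  refine ⟨v, hv, ?_⟩
  rw [← NNReal.coe_le_coe] at hv'
  push_cast [Real.coe_toNNReal _ hγ0] at hv'
  exact hv'

end AsymptoticStability

/-! ### Practical stability from nonlinear value bounds -/

section PracticalStability

open Filter Topology

variable {E F : Type*} {g : E → F → E} {X : Set E} {U : Set F} {ω ℓ : E → ℝ≥0}

/-- Along an optimal trajectory over a long horizon the running cost is small at some intermediate
time, so the optimal value decreases by the running cost up to a small error. -/
lemma IsOptimal.cost_succ_le_add {B : ℝ≥0 → ℝ≥0} (hB : Monotone B)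
    (hval : ∀ N, ∀ ξ ∈ X, ∃ u, IsFeasible g X U N ξ u ∧ cost g ℓ N ξ u ≤ B (ℓ ξ)) {n : ℕ}
    {ξ : E} (hξ : ξ ∈ X) {u u' : ℕ → F} (hu : IsOptimal g X U ℓ (n + 2) ξ u)
    (hu' : IsOptimal g X U ℓ (n + 2) (g ξ (u 0)) u') :
    cost g ℓ (n + 2) (g ξ (u 0)) u' + ℓ ξ ≤
      cost g ℓ (n + 2) ξ u + B (cost g ℓ (n + 2) ξ u / (n + 1 : ℕ)) := by
  have hpos : (0 : ℝ≥0) < ((n + 1 : ℕ) : ℝ≥0) := by positivity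
  -- Pigeonhole over times `1, …, n + 1`; time `0` is excluded since the successor is already
  -- reached.
  obtain ⟨k, hk, hle⟩ : ∃ k ∈ Finset.range (n + 1),
      ℓ (solution g ξ u (k + 1)) ≤ cost g ℓ (n + 2) ξ u / (n + 1 : ℕ) := by
    refine Finset.exists_le_of_sum_le ⟨0, by simp⟩ ?_
    rw [Finset.sum_const, Finset.card_range, nsmul_eq_mul, mul_div_cancel₀ _ hpos.ne']
    simp only [cost]
    rw [Finset.sum_range_succ' _ (n + 1)]
    exact le_self_add
  rw [Finset.mem_range] at hk
  have hf : IsFeasible g X U (k + 1) ξ u := hu.1.mono (by omega)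
  obtain ⟨v, hv, hc⟩ := hval (n + 2 - k) _ (hf.solution_mem hξ)
  have hN : n + 2 = k + (n + 2 - k) := by omega
  have h := IsOptimal.cost_succ_le hf (hN ▸ hu') hv
  rw [← hN] at h
  exact h.trans (add_le_add (cost_mono ξ u (by omega)) (hc.trans (hB hle)))

/-- A bound on the optimal value in terms of the running cost, uniform in the horizon, yields
semiglobal practical stability. -/
theorem mpcSemigloballyPracticallyStabilizing_of_value_bound {αl αu B₀ : ℝ≥0 → ℝ≥0}
    (hl : IsClassKInf αl) (hu : IsClassKInf αu) (hb : ∀ ξ, αl (ω ξ) ≤ ℓ ξ ∧ ℓ ξ ≤ αu (ω ξ))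
    (hc : Continuous B₀) (hm : Monotone B₀) (h0 : B₀ 0 = 0)
    (hval : ∀ N, ∀ ξ ∈ X, ∃ u, IsFeasible g X U N ξ u ∧ cost g ℓ N ξ u ≤ B₀ (ℓ ξ)) :
    MPCSemigloballyPracticallyStabilizing g X U ω ℓ := by
  obtain ⟨el, rfl⟩ := hl.exists_orderIso
  -- Adding the identity to `B₀` makes the bound invertible.
  have hBK := isClassKInf_id_add hc hm h0
  obtain ⟨B, hB⟩ := hBK.exists_orderIso
  have hBr : ∀ r, B r = r + B₀ r := fun r => congrFun hB r
  have hval' : ∀ N, ∀ ξ ∈ X, ∃ u, IsFeasible g X U N ξ u ∧ cost g ℓ N ξ u ≤ B (ℓ ξ) := by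
    intro N ξ hξ
    obtain ⟨u, hu, hcu⟩ := hval N ξ hξ
    exact ⟨u, hu, hcu.trans (by rw [hBr]; exact le_add_self)⟩
  -- the inverse of `B` is nonexpansive
  have hBinv : ∀ y, B.symm y + B₀ (B.symm y) = y := fun y => by
    rw [← hBr, B.apply_symm_apply]
  have hBle : ∀ y, B.symm y ≤ y := fun y => by
    conv_rhs => rw [← hBinv y]
    exact le_self_add
  -- This is `y - B⁻¹ y / 2`, written without subtraction so that its monotonicity is evident: half
  -- of the guaranteed decrease, the other half absorbing the error.
  let h : ℝ≥0 → ℝ≥0 := fun y => 2⁻¹ * B.symm y + B₀ (B.symm y)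
  have hhy : ∀ y, h y + 2⁻¹ * B.symm y = y := fun y => by
    have h2 : (2⁻¹ : ℝ≥0) * B.symm y + 2⁻¹ * B.symm y = B.symm y := by
      rw [← add_mul, ← two_mul, mul_inv_cancel₀ two_ne_zero, one_mul]
    simp only [h]
    conv_rhs => rw [← hBinv y]
    rw [add_right_comm, h2]
  have hhK : IsClassKInf h := by
    have hid : IsClassKInf fun r : ℝ≥0 => 2⁻¹ * r := isClassKInf_id.const_mul (by norm_num)
    have h1 : IsClassKInf fun r => 2⁻¹ * r + B₀ r :=
      ⟨⟨hid.1.1.add hc, hid.1.2.1.add_monotone hm, by simp [h0]⟩,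
        tendsto_atTop_mono (fun _ => le_self_add) hid.2⟩
    exact h1.comp (isClassKInf_orderIso B.symm)
  have hhlt : ∀ s, 0 < s → h s < s := fun s hs => by
    have hp : 0 < B.symm s := by
      have := B.symm.strictMono hs
      rwa [show B.symm 0 = 0 from B.symm.map_bot] at this
    conv_rhs => rw [← hhy s]
    exact lt_add_of_pos_right _ (by positivity)
  obtain ⟨σ, hσ, hσh⟩ := exists_rescaling hhK hhlt
  obtain ⟨eσ, rfl⟩ := hσ.exists_orderIso
  have hB0 : B 0 = 0 := B.map_bot
  have htwo : (2⁻¹ : ℝ≥0) < 1 := by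
    rw [← NNReal.coe_lt_coe]
    norm_num
  refine ⟨fun r s => (el.symm ∘ eσ.symm) ((2⁻¹ : ℝ≥0) ^ (s : ℝ) * (eσ ∘ B ∘ αu) r),
    isClassKL_of_rpow
      ((isClassKInf_orderIso el.symm).comp (isClassKInf_orderIso eσ.symm)).1
      ((isClassKInf_orderIso eσ).comp ((isClassKInf_orderIso B).comp hu)).1 (by norm_num)
      htwo, ?_⟩
  intro δ Δ hδ hδΔ
  have hη : 0 < el δ := by
    have := el.strictMono hδ
    rwa [show el 0 = 0 from el.map_bot] at this
  -- Bounds the initial optimal values. The level `Y ≤ R` is shown to be invariant, so one horizon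
  -- controls the error at all times.
  set R : ℝ≥0 := B (αu Δ)
  have hR : 0 < R := by
    have := B.strictMono (hu.1.2.1 (hδ.trans hδΔ))
    rw [hu.1.2.2, hB0] at this
    exact this
  -- choice of the error `ε`
  obtain ⟨ε, hε0, hε⟩ : ∃ ε, 0 < ε ∧ B (2 * ε) + ε ≤ min (el δ) R := by
    have hcont : Continuous fun ε => B (2 * ε) + ε :=
      (B.continuous.comp (continuous_const.mul continuous_id)).add continuous_id
    have ht := hcont.tendsto 0
    rw [mul_zero, hB0, zero_add] at ht
    have hev := ht.eventually (gt_mem_nhds (lt_min hη hR))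
    have hw : ∀ᶠ ε in 𝓝[>] (0 : ℝ≥0), B (2 * ε) + ε < min (el δ) R :=
      hev.filter_mono nhdsWithin_le_nhds
    obtain ⟨ε, h1, h2⟩ := (hw.and self_mem_nhdsWithin).exists
    exact ⟨ε, h2, h1.le⟩
  -- choice of the horizon
  obtain ⟨n₀, hn₀⟩ : ∃ n₀ : ℕ, ∀ n ≥ n₀, B (R / (n + 1 : ℕ)) ≤ ε := by
    have h1 : Tendsto (fun n : ℕ => R / ((n + 1 : ℕ) : ℝ≥0)) atTop (𝓝 0) := by
      have h2 : Tendsto (fun n : ℕ => R / (n : ℝ≥0)) atTop (𝓝 0) := by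
        simpa [div_eq_mul_inv] using
          (tendsto_inv_atTop_zero.comp (tendsto_natCast_atTop_atTop (R := ℝ≥0))).const_mul R
      exact h2.comp (tendsto_add_atTop_nat 1)
    have h2 := (B.continuous.tendsto 0).comp h1
    rw [hB0] at h2
    obtain ⟨n₀, h3⟩ := eventually_atTop.1 (h2.eventually (gt_mem_nhds hε0))
    exact ⟨n₀, fun n hn => (h3 n hn).le⟩
  refine ⟨n₀ + 2, by omega, fun N hN x hx hxΔ t => ?_⟩
  obtain ⟨n, rfl⟩ := Nat.exists_eq_add_of_le' ((Nat.le_add_left 2 n₀).trans hN)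
  choose u hopt hnext using hx.2
  have hmem := hx.mem (by omega : 1 ≤ n + 2)
  set Y : ℕ → ℝ≥0 := fun t => cost g ℓ (n + 2) (x t) (u t)
  have hYB : ∀ t, Y t ≤ B (ℓ (x t)) := fun t => by
    obtain ⟨v, hv, hcv⟩ := hval' (n + 2) _ (hmem t)
    exact ((hopt t).2 v hv).trans hcv
  have hY0 : Y 0 ≤ B (αu (ω (x 0))) := (hYB 0).trans (B.monotone (hb _).2)
  -- Either `ε` is at most half of `B⁻¹ (Y t)`, and `h` bounds the next value, or `Y t ≤ B (2 * ε)`,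
  -- and the next value is at most `B (2 * ε) + ε`.
  have hstep : ∀ t, Y t ≤ R → Y (t + 1) ≤ max (h (Y t)) (min (el δ) R) := by
    intro t ht
    have ho := hopt (t + 1)
    rw [hnext t] at ho
    have h1 := IsOptimal.cost_succ_le_add B.monotone hval' (hmem t) (hopt t) ho
    rw [← hnext t] at h1
    have h2 : Y (t + 1) + ℓ (x t) ≤ Y t + ε :=
      h1.trans (by
        gcongr
        exact (B.monotone (by gcongr)).trans (hn₀ n (by omega)))
    have h3 : B.symm (Y t) ≤ ℓ (x t) := by
      rw [B.symm_apply_le]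
      exact hYB t
    rcases le_total ε (2⁻¹ * B.symm (Y t)) with hcase | hcase
    · refine le_max_of_le_left ?_
      have h4 := hhy (Y t)
      have h5 : (2⁻¹ : ℝ≥0) * B.symm (Y t) + 2⁻¹ * B.symm (Y t) = B.symm (Y t) := by
        rw [← add_mul, ← two_mul, mul_inv_cancel₀ two_ne_zero, one_mul]
      rw [← NNReal.coe_le_coe] at h2 h3 hcase ⊢
      rw [← NNReal.coe_inj] at h4 h5
      simp only [NNReal.coe_add] at h2 h4 h5
      linarith
    · refine le_max_of_le_right (le_trans ?_ hε)
      have h4 : B.symm (Y t) ≤ 2 * ε := by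
        rwa [inv_mul_le_iff₀ two_pos] at hcase
      rw [B.symm_apply_le] at h4
      exact (le_self_add.trans h2).trans (add_le_add_left h4 ε)
  have hmain : ∀ t, Y t ≤ R ∧ eσ (Y t) ≤ max (2⁻¹ ^ t * eσ (B (αu (ω (x 0))))) (eσ (el δ)) := by
    intro t
    induction t with
    | zero =>
      refine ⟨hY0.trans (B.monotone (hu.1.2.1.monotone hxΔ.le)), le_max_of_le_left ?_⟩
      rw [pow_zero, one_mul]
      exact eσ.monotone hY0
    | succ t ih =>
      have h1 := hstep t ih.1
      have hhle : h (Y t) ≤ Y t := by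
        conv_rhs => rw [← hhy (Y t)]
        exact le_self_add
      refine ⟨h1.trans (max_le (hhle.trans ih.1) (min_le_right _ _)), ?_⟩
      rcases le_max_iff.1 h1 with h2 | h2
      · have h3 : eσ (Y (t + 1)) ≤ 2⁻¹ * eσ (Y t) := (eσ.monotone h2).trans (hσh _)
        rcases le_max_iff.1 ih.2 with h4 | h4
        · refine le_max_of_le_left (h3.trans ?_)
          rw [pow_succ', mul_assoc]
          gcongr
        · exact le_max_of_le_right
            (h3.trans ((mul_le_of_le_one_left zero_le htwo.le).trans h4))
      · exact le_max_of_le_right (eσ.monotone (h2.trans (min_le_left _ _)))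
  have hfin : el (ω (x t)) ≤ Y t := (hb _).1.trans (le_cost _ _ (by omega))
  rw [le_max_iff]
  simp only [Function.comp_apply, NNReal.coe_natCast, NNReal.rpow_natCast, el.le_symm_apply,
    eσ.le_symm_apply]
  rcases le_max_iff.1 (hmain t).2 with h1 | h1
  · exact Or.inl ((eσ.monotone hfin).trans h1)
  · exact Or.inr (el.le_iff_le.1 (hfin.trans (eσ.le_iff_le.1 h1)))

/-- Powers are multiplicative, so replacing `r` by `c * r` scales each power term of a potential by
a constant below one; the coefficients then solve scalar fixed point equations. -/
theorem mpcSemigloballyPracticallyStabilizing_of_linear_decay {αl αu : ℝ≥0 → ℝ≥0}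
    (hl : IsClassKInf αl) (hu : IsClassKInf αu) {V : E → ℝ≥0}
    (hb : ∀ ξ, αl (ω ξ) ≤ V ξ ∧ V ξ ≤ αu (ω ξ)) {M : ℕ} (hM : 1 ≤ M) {q : E → ℕ → F}
    (hq : IsAdmissibleFeedback g X U ω M q) {c : ℝ≥0} (hc : c < 1)
    (hdec : HasDecay g X V M q (fun s => c * s)) {κ : ℝ≥0 → ℝ≥0}
    (htr : HasTransientBound g X V M q κ) {p : ℝ≥0} {a b : ℝ} (ha : 0 < a) (hb' : 0 < b)
    (hκ : ∀ r, κ r ≤ p * max (r ^ a) (r ^ b)) :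
    MPCSemigloballyPracticallyStabilizing g X U ω V := by
  set P : ℝ≥0 := (M - 1 : ℕ) * p
  -- solutions of the fixed point equations `1 + A c = A`, `P + A c ^ s = A`
  have hfix : ∀ s : ℝ, 0 < s → P + P / (1 - c ^ s) * c ^ s = P / (1 - c ^ s) := by
    intro s hs
    have h1 : c ^ s < 1 := NNReal.rpow_lt_one hc hs
    have h2 : 0 < 1 - c ^ s := tsub_pos_of_lt h1
    have h3 : (1 - c ^ s) + c ^ s = 1 := tsub_add_cancel_of_le h1.le
    have h4 : P = P / (1 - c ^ s) * (1 - c ^ s) := (div_mul_cancel₀ _ h2.ne').symm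
    nth_rw 1 [h4]
    rw [← mul_add, h3, mul_one]
  have hfix1 : 1 + 1 / (1 - c) * c = 1 / (1 - c) := by
    have h2 : 0 < 1 - c := tsub_pos_of_lt hc
    have h3 : (1 - c) + c = 1 := tsub_add_cancel_of_le hc.le
    have h4 : (1 : ℝ≥0) = 1 / (1 - c) * (1 - c) := (div_mul_cancel₀ _ h2.ne').symm
    nth_rw 1 [h4]
    rw [← mul_add, h3, mul_one]
  set A₁ : ℝ≥0 := 1 / (1 - c)
  set A₂ : ℝ≥0 := P / (1 - c ^ a)
  set A₃ : ℝ≥0 := P / (1 - c ^ b)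
  let D : ℝ≥0 → ℝ≥0 := fun r => A₁ * r + A₂ * r ^ a + A₃ * r ^ b
  have hDm : Monotone D := fun r s h => by
    simp only [D]
    gcongr
  have hDc : Continuous D :=
    ((continuous_const.mul continuous_id).add
      (continuous_const.mul (NNReal.continuous_rpow_const ha.le))).add
      (continuous_const.mul (NNReal.continuous_rpow_const hb'.le))
  have hD0 : D 0 = 0 := by simp [D, NNReal.zero_rpow ha.ne', NNReal.zero_rpow hb'.ne']
  refine mpcSemigloballyPracticallyStabilizing_of_value_bound hl hu hb hDc hDm hD0
    fun N => exists_feasible_cost_le_of_potential hM (fun ξ => D (V ξ)) (fun ξ hξ => ?_) N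
  refine ⟨q ξ, hq.isFeasible hξ, ?_⟩
  have h1 := cost_le_of_transient_bound hM (htr ξ hξ)
  have h2 := hDm (hdec ξ hξ)
  set r := V ξ
  calc _ ≤ (r + (M - 1 : ℕ) * κ r) + D (c * r) := add_le_add h1 h2
    _ ≤ (r + (M - 1 : ℕ) * (p * (r ^ a + r ^ b))) + D (c * r) := by
      gcongr
      refine (hκ r).trans ?_
      gcongr
      exact max_le le_self_add le_add_self
    _ = (1 + A₁ * c) * r + (P + A₂ * c ^ a) * r ^ a + (P + A₃ * c ^ b) * r ^ b := by
      simp only [D, P, NNReal.mul_rpow]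
      ring
    _ = D r := by rw [hfix1, hfix a ha, hfix b hb']

/-- An admissible feedback satisfies a transient bound of class `𝒦_∞` that dominates the
identity. -/
lemma IsAdmissibleFeedback.exists_transient_bound {αl αu : ℝ≥0 → ℝ≥0} (hl : IsClassKInf αl)
    (hu : IsClassKInf αu) {V : E → ℝ≥0} (hb : ∀ ξ, αl (ω ξ) ≤ V ξ ∧ V ξ ≤ αu (ω ξ)) {M : ℕ}
    {q : E → ℕ → F} (hq : IsAdmissibleFeedback g X U ω M q) :
    ∃ κ, IsClassKInf κ ∧ ∀ ξ ∈ X, ∀ i < M, V (solution g ξ (q ξ) i) ≤ κ (V ξ) := by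
  obtain ⟨el, rfl⟩ := hl.exists_orderIso
  have hex : ∀ j, ∃ κ, IsClassK κ ∧
      ∀ ξ ∈ X, 1 ≤ j → j ≤ M → ω (solution g ξ (q ξ) j) ≤ κ (ω ξ) := by
    intro j
    by_cases hj : 1 ≤ j ∧ j ≤ M
    · obtain ⟨κ, hκ, h⟩ := hq.2.2 j hj.1 hj.2
      exact ⟨κ, hκ, fun ξ hξ _ _ => h ξ hξ⟩
    · exact ⟨_, isClassKInf_id.1, fun ξ _ h1 h2 => absurd ⟨h1, h2⟩ hj⟩
  choose k hk hkb using hex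
  have hkK : ∀ j, IsClassK (αu ∘ k j ∘ el.symm) := fun j =>
    hu.1.comp ((hk j).comp (isClassKInf_orderIso el.symm).1)
  -- The summand `r` covers `i = 0` and makes the bound unbounded.
  refine ⟨fun r => r + ∑ j ∈ Finset.range M, (αu ∘ k j ∘ el.symm) r,
    isClassKInf_id_add (continuous_finsetSum _ fun j _ => (hkK j).1)
      (fun r s h => Finset.sum_le_sum fun j _ => (hkK j).2.1.monotone h)
      (Finset.sum_eq_zero fun j _ => (hkK j).2.2), fun ξ hξ i hi => ?_⟩
  rcases Nat.eq_zero_or_pos i with rfl | hi0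
  · exact le_self_add
  · refine le_add_of_nonneg_of_le zero_le (le_trans ?_ (Finset.single_le_sum
      (f := fun j => (αu ∘ k j ∘ el.symm) (V ξ)) (fun _ _ => zero_le) (Finset.mem_range.2 hi)))
    refine (hb _).2.trans (hu.1.2.1.monotone ((hkb i ξ hξ hi0 hi.le).trans
      ((hk i).2.1.monotone ?_)))
    rw [el.le_symm_apply]
    exact (hb ξ).1

theorem exists_rescaled_cost_stabilizing {αl αu : ℝ≥0 → ℝ≥0} (hl : IsClassKInf αl)
    (hu : IsClassKInf αu) {V : E → ℝ≥0} (hb : ∀ ξ, αl (ω ξ) ≤ V ξ ∧ V ξ ≤ αu (ω ξ)) {M : ℕ}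
    (hM : 1 ≤ M) {q : E → ℕ → F} (hq : IsAdmissibleFeedback g X U ω M q) {α : ℝ≥0 → ℝ≥0}
    (hα : IsClassKInf α) (hlt : ∀ s, 0 < s → α s < s) (hdec : HasDecay g X V M q α) :
    ∃ ρ, IsClassKInf ρ ∧
      MPCSemigloballyPracticallyStabilizing g X U ω (fun x => ρ (V x)) := by
  obtain ⟨κ, hκ, htr⟩ := hq.exists_transient_bound hl hu hb
  obtain ⟨e, rfl⟩ := hκ.exists_orderIso
  obtain ⟨σ, hσ, hσα⟩ := exists_rescaling hα hlt
  obtain ⟨s, rfl⟩ := hσ.exists_orderIso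
  -- With `ρ = s ∘ κ⁻¹`, each cost in a block is at most `ρ (κ (V ξ)) = s (V ξ)`. Since `s ∘ V`
  -- halves over the block, the potential `2 * M * s (V ξ)` pays for all `M` of them.
  let ρ : ℝ≥0 ≃o ℝ≥0 := e.symm.trans s
  have hρe : ∀ r, ρ (e r) = s r := fun r => congrArg s (e.symm_apply_apply r)
  have hρ := isClassKInf_orderIso ρ
  let D : ℝ≥0 ≃o ℝ≥0 := ρ.symm.trans s
  refine ⟨ρ, hρ, mpcSemigloballyPracticallyStabilizing_of_value_bound (hρ.comp hl) (hρ.comp hu)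
    (fun ξ => ⟨ρ.monotone (hb ξ).1, ρ.monotone (hb ξ).2⟩)
    (B₀ := fun r => 2 * M * D r) (continuous_const.mul D.continuous)
    (fun a b h => mul_le_mul_right (D.monotone h) _)
    (by simp [show D 0 = 0 from D.map_bot]) fun N => ?_⟩
  have hDρ : ∀ ξ, D (ρ (V ξ)) = s (V ξ) := fun ξ => congrArg s (ρ.symm_apply_apply _)
  simp only [hDρ]
  refine exists_feasible_cost_le_of_potential hM (fun ξ => 2 * M * s (V ξ)) (fun ξ hξ => ?_) N
  refine ⟨q ξ, hq.isFeasible hξ, ?_⟩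
  have h1 : cost g (fun x => ρ (V x)) M ξ (q ξ) ≤ M * s (V ξ) := by
    have := Finset.sum_le_card_nsmul (Finset.range M)
      (fun i => ρ (V (solution g ξ (q ξ) i))) (s (V ξ)) fun i hi => by
        rw [← hρe]
        exact ρ.monotone (htr ξ hξ i (Finset.mem_range.1 hi))
    simpa [cost] using this
  have h2 : s (V (solution g ξ (q ξ) M)) ≤ 2⁻¹ * s (V ξ) := (s.monotone (hdec ξ hξ)).trans (hσα _)
  calc _ ≤ M * s (V ξ) + 2 * M * (2⁻¹ * s (V ξ)) := by gcongr
    _ = M * s (V ξ) + (2 * 2⁻¹) * M * s (V ξ) := by ring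
    _ = _ := by rw [mul_inv_cancel₀ two_ne_zero]; ring

end PracticalStability

end FiniteStepMPC

theorem theorem2 {n m : ℕ}
    (g : EuclideanSpace ℝ (Fin n) → EuclideanSpace ℝ (Fin m) → EuclideanSpace ℝ (Fin n))
    (X : Set (EuclideanSpace ℝ (Fin n))) (U : Set (EuclideanSpace ℝ (Fin m)))
    (ω : EuclideanSpace ℝ (Fin n) → ℝ≥0) (hω : IsMeasurementFunction ω)
    (M : ℕ) (hM : 1 ≤ M)
    (V : EuclideanSpace ℝ (Fin n) → ℝ≥0) (hV : IsFiniteStepCLF g X U ω M V) :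
    -- (i) linear decay and linear transient bound
    (∀ q, IsAdmissibleFeedback g X U ω M q →
      ∀ c d : ℝ≥0, c < 1 → 0 < d →
        HasDecay g X V M q (fun s => c * s) →
        HasTransientBound g X V M q (fun r => d * r) →
        ∀ γ : ℝ, γ = (M : ℝ) * (d : ℝ) / (1 - (c : ℝ)) →
          ∀ N : ℕ, 2 ≤ N →
            (1 < γ →
              (N : ℝ) > 2 + Real.log (γ - 1) / (Real.log γ - Real.log (γ - 1))) →
            MPCAsymptoticallyStable g X U ω V N) ∧
    -- (ii) linear decay and transient bound of power type
    (∀ q, IsAdmissibleFeedback g X U ω M q →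
      ∀ c : ℝ≥0, c < 1 → HasDecay g X V M q (fun s => c * s) →
        ∀ κ, IsClassKInf κ → HasTransientBound g X V M q κ →
          ∀ (p : ℝ≥0) (a b : ℝ), 0 < p → 0 < a → 0 < b →
            (∀ r, κ r ≤ p * max (r ^ a) (r ^ b)) →
            MPCSemigloballyPracticallyStabilizing g X U ω V) ∧
    -- (iii) the general case, after rescaling the running cost
    (∃ ρ, IsClassKInf ρ ∧
      MPCSemigloballyPracticallyStabilizing g X U ω (fun x => ρ (V x))) := by
  obtain ⟨-, ⟨αl, αu, hl, hu, hb⟩, q, α, hq, hα, hlt, hdec⟩ := hV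
  refine ⟨fun q hq c d hc _ hdec htr γ hγ N hN hNγ => ?_,
    fun q hq c hc hdec κ _ htr p a b _ ha hb' hκ => ?_, ?_⟩
  · exact mpcAsymptoticallyStable_of_linear_decay hl hu hb hM hq hc hdec htr hγ hN hNγ
  · exact mpcSemigloballyPracticallyStabilizing_of_linear_decay hl hu hb hM hq hc hdec htr ha hb' hκ
  · exact exists_rescaled_cost_stabilizing hl hu hb hM hq hα hlt hdec
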